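/- Let $m\ge 0$ and let $v\in\mathbb{R}^{m+1}$ be a unit vector. Let $x:\Sigma^m\to\mathbb{R}^{m+1}$ be a translator of the mean curvature flow with velocity $v$, i.e. a smooth isometric immersion of a connected, complete Riemannian manifold $\Sigma$ of dimension $m$ (without boundary) whose mean curvature vector $\mathbf{H}=\mathrm{tr}(\mathbf{A})$, with $\mathbf{A}=D\,dx$ the second fundamental form, satisfies $\mathbf{H}=v^{\perp}$, where $v^\perp$ denotes the component of $v$ normal to $\Sigma$. Put $f=-\langle x,v\rangle$ and let $\Delta_f=\Delta-\langle\nabla f,\nabla\,\cdot\,\rangle$ be the $f$-Laplacian on $\Sigma$. Assume that $\Sigma$ is $f$-stochastically complete, i.e. that the diffusion process on $\Sigma$ generated by $\Delta_f$ has, from every starting point, almost surely infinite lifetime (equivalently: for every $p\in\Sigma$ there is a process with continuous paths $[0,\infty)\to\Sigma$, starting at $p$, that solves the martingale problem for $\Delta_f$ on $C_c^\infty(\Sigma)$). Then for no $b\in\mathbb{R}$ is $x(\Sigma)$ contained in the lower halfspace $\{p\in\mathbb{R}^{m+1}:\langle p,v\rangle\le b\}$. In particular, $x(\Sigma)$ is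 not bounded. -/

import Mathlib

open MeasureTheory ProbabilityTheory Set Bundle
open scoped Manifold ContDiff NNReal

noncomputable section

namespace TranslatorMCF

universe u

/-- Euclidean space `ℝ^n`. -/
abbrev Euc (n : ℕ) : Type := EuclideanSpace ℝ (Fin n)

/-- The `i`-th coordinate derivative of a function on (an open subset of) `ℝ^m`. -/
def coordDeriv {m : ℕ} {F : Type*} [NormedAddCommGroup F] [NormedSpace ℝ F]
    (i : Fin m) (h : Euc m → F) (y : Euc m) : F :=
  fderiv ℝ h y (EuclideanSpace.single i 1)

section Riemannian

/-! Local expressions, in the preferred chart around a point `c`, of the objects attached to the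
Riemannian metric of `M`. The variable `y` ranges over the image of that chart. -/

variable {m : ℕ} {M : Type u} [TopologicalSpace M] [ChartedSpace (Euc m) M]
  [RiemannianBundle (fun p : M ↦ TangentSpace (𝓡 m) p)]
  {F : Type*} [NormedAddCommGroup F] [NormedSpace ℝ F]

/-- The differential at `y` of the inverse of the chart around `c`; it maps the standard basis of
`ℝ^m` to the coordinate vectors `∂_1, …, ∂_m` at the point of `M` with coordinates `y`. -/
def chartSymmDeriv (c : M) (y : Euc m) :
    Euc m →L[ℝ] TangentSpace (𝓡 m) ((extChartAt (𝓡 m) c).symm y) :=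
  mfderiv 𝓘(ℝ, Euc m) (𝓡 m) (extChartAt (𝓡 m) c).symm y

/-- The metric coefficients `g_{ij} = ⟨∂_i, ∂_j⟩`. -/
def metricCoeff (c : M) (y : Euc m) : Matrix (Fin m) (Fin m) ℝ :=
  Matrix.of fun i j ↦ inner ℝ
    (chartSymmDeriv c y (EuclideanSpace.single i 1))
    (chartSymmDeriv c y (EuclideanSpace.single j 1))

/-- The Christoffel symbols `Γ^k_{ij}` of the Levi-Civita connection. -/
def christoffel (c : M) (y : Euc m) (k i j : Fin m) : ℝ :=
  (1 / 2 : ℝ) * ∑ l, (metricCoeff c y)⁻¹ k l *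
    (coordDeriv i (fun z ↦ metricCoeff c z j l) y
      + coordDeriv j (fun z ↦ metricCoeff c z i l) y
      - coordDeriv l (fun z ↦ metricCoeff c z i j) y)

/-- The coefficients `(D dw)_{ij} = ∂_i ∂_j w - Γ^k_{ij} ∂_k w` of the (generalized) Hessian of a
function `w` with values in a fixed vector space. -/
def hessCoeff (w : M → F) (c : M) (y : Euc m) (i j : Fin m) : F :=
  coordDeriv i (coordDeriv j (w ∘ (extChartAt (𝓡 m) c).symm)) y
    - ∑ k, christoffel c y k i j • coordDeriv k (w ∘ (extChartAt (𝓡 m) c).symm) y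

/-- The metric trace `g^{ij} (D dw)_{ij}` of the Hessian. -/
def traceHessInChart (w : M → F) (c : M) (y : Euc m) : F :=
  ∑ i, ∑ j, (metricCoeff c y)⁻¹ i j • hessCoeff w c y i j

/-- `⟨∇f, ∇w⟩ = g^{ij} ∂_i f ∂_j w`. -/
def gradInnerInChart (f w : M → ℝ) (c : M) (y : Euc m) : ℝ :=
  ∑ i, ∑ j, (metricCoeff c y)⁻¹ i j *
    (coordDeriv i (f ∘ (extChartAt (𝓡 m) c).symm) y
      * coordDeriv j (w ∘ (extChartAt (𝓡 m) c).symm) y)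

variable (m) in
/-- The weighted Laplacian `Δ_f w = Δ w - ⟨∇f, ∇w⟩` of the Riemannian manifold `M`. -/
def weightedLaplacian (f w : M → ℝ) (p : M) : ℝ :=
  traceHessInChart w p (extChartAt (𝓡 m) p p) - gradInnerInChart f w p (extChartAt (𝓡 m) p p)

variable (m) in
/-- The process `X`, on the filtered probability space `(Ω, ℱ, P)`, is a diffusion generated by
`Δ_f` that starts at `p` and lives in `M` for all times: it is adapted, has continuous paths
`[0, ∞) → M`, and solves the martingale problem for `Δ_f` on `C_c^∞(M)`. -/
structure IsDiffusionFrom (f : M → ℝ) (p : M) {Ω : Type*} [mΩ : MeasurableSpace Ω]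
    (P : Measure Ω) (ℱ : Filtration ℝ≥0 mΩ) (X : ℝ≥0 → Ω → M) : Prop where
  isProbabilityMeasure : IsProbabilityMeasure P
  adapted : ∀ t, Measurable[ℱ t, borel M] (X t)
  continuous_paths : ∀ o, Continuous fun t ↦ X t o
  start : ∀ᵐ o ∂P, X 0 o = p
  martingale : ∀ φ : M → ℝ, ContMDiff (𝓡 m) 𝓘(ℝ, ℝ) ∞ φ → HasCompactSupport φ →
    Martingale
      (fun t o ↦ φ (X t o) - ∫ s in (0 : ℝ)..t, weightedLaplacian m f φ (X s.toNNReal o)) ℱ P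

variable (m) in
/-- `f`-stochastic completeness: the diffusion generated by `Δ_f` does not explode. Since the
coefficients of `Δ_f` are smooth, its martingale problem is well posed up to the explosion time,
so the diffusion issued from `p` has almost surely infinite lifetime if and only if there is a
solution with continuous paths in `M` defined on all of `[0, ∞)`. (Taking `½ Δ_f` as the generator
only changes the speed of time.) -/
def IsStochasticallyComplete (f : M → ℝ) : Prop :=
  ∀ p : M, ∃ (Ω : Type u) (mΩ : MeasurableSpace Ω) (P : Measure Ω) (ℱ : Filtration ℝ≥0 mΩ)
    (X : ℝ≥0 → Ω → M), IsDiffusionFrom m f p P ℱ X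

end Riemannian

section Hypersurface

variable (m : ℕ) {M : Type u}

/-- The differential `dx_p : T_pM → ℝ^n`. -/
def differential {n : ℕ} [TopologicalSpace M] [ChartedSpace (Euc m) M] (x : M → Euc n) (p : M) :
    TangentSpace (𝓡 m) p →L[ℝ] Euc n :=
  mfderiv (𝓡 m) 𝓘(ℝ, Euc n) x p

/-- The component `w^⊥` of `w` normal to the immersed manifold at `p`. -/
def normalPart {n : ℕ} [TopologicalSpace M] [ChartedSpace (Euc m) M] (x : M → Euc n) (p : M)
    (w : Euc n) : Euc n :=
  (LinearMap.range (differential m x p).toLinearMap)ᗮ.starProjection w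

/-- The mean curvature vector `𝐇 = tr 𝐀`, where the second fundamental form `𝐀 = D dx` is the
generalized Hessian of the immersion `x`. -/
def meanCurvatureVector {n : ℕ} [TopologicalSpace M] [ChartedSpace (Euc m) M]
    [RiemannianBundle (fun p : M ↦ TangentSpace (𝓡 m) p)] (x : M → Euc n) (p : M) : Euc n :=
  traceHessInChart x p (extChartAt (𝓡 m) p p)

/-- `x : M → ℝ^{m+1}` is a translator with velocity `v`: a smooth isometric immersion of the
connected complete Riemannian manifold `M` such that `𝐇 = v^⊥`, where `|v| = 1`. -/
structure IsTranslator [EMetricSpace M] [ChartedSpace (Euc m) M]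
    [RiemannianBundle (fun p : M ↦ TangentSpace (𝓡 m) p)]
    (x : M → Euc (m + 1)) (v : Euc (m + 1)) : Prop where
  connected : ConnectedSpace M
  complete : CompleteSpace M
  smooth : ContMDiff (𝓡 m) 𝓘(ℝ, Euc (m + 1)) ∞ x
  isometric : ∀ (p : M) (X Y : TangentSpace (𝓡 m) p),
    inner ℝ (differential m x p X) (differential m x p Y) = inner ℝ X Y
  norm_velocity : ‖v‖ = 1
  translator_eq : ∀ p : M, meanCurvatureVector m x p = normalPart m x p v

end Hypersurface

end TranslatorMCF

end

/-!
For `f = -⟨x, v⟩` and any `w`, the trace of the Hessian of `⟨x, w⟩` is `⟨𝐇, w⟩ = ⟨v^⊥, w⟩`, while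
`-⟨∇f, ∇⟨x, w⟩⟩ = ⟨v^⊤, w⟩`; hence `Δ_f ⟨x, w⟩ = ⟨v, w⟩` is constant. Along a diffusion generated by
`Δ_f` the height in a direction `w` with `⟨v, w⟩ > 0` therefore grows linearly in mean, and if the
diffusion lives forever the height cannot be bounded above.

To localize, multiply `⟨x, w⟩ - b ≤ 0` by a cutoff function equal to one near a compact set `K` and
stop the resulting martingale at the exit time from `K`. Discretizing this time along a grid of
`[0, t]` gives stopping times with finitely many values; the stopped values are conditional
expectations of one variable, hence uniformly integrable, which allows the mesh to tend to zero.
-/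

open Filter Topology
open scoped ENNReal

namespace TranslatorMCF

section Probability

variable {Ω : Type*} {mΩ : MeasurableSpace Ω} {P : Measure Ω}

theorem unifIntegrable_of_norm_le {ι E F : Type*} [NormedAddCommGroup E] [NormedAddCommGroup F]
    {p : ℝ≥0∞} {f : ι → Ω → E} {g : ι → Ω → F} (hg : UnifIntegrable g p P)
    (hfg : ∀ i o, ‖f i o‖ ≤ ‖g i o‖) : UnifIntegrable f p P := by
  intro ε hε
  obtain ⟨δ, hδ, hgδ⟩ := hg hε
  refine ⟨δ, hδ, fun i s hs hPs ↦ (eLpNorm_mono fun o ↦ ?_).trans (hgδ i s hs hPs)⟩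
  simpa only [norm_indicator_eq_indicator_norm] using indicator_le_indicator (hfg i o)

/-- A form of the reverse Fatou lemma in which uniform integrability replaces domination. -/
theorem le_integral_of_forall_le_integral_of_eventually_le [IsFiniteMeasure P] {g : ℕ → Ω → ℝ}
    {h : Ω → ℝ} {c : ℝ} (hg : UniformIntegrable g 1 P) (hh : Integrable h P)
    (hgh : ∀ᵐ o ∂P, ∀ᶠ n in atTop, g n o ≤ h o) (hc : ∀ n, c ≤ ∫ o, g n o ∂P) :
    c ≤ ∫ o, h o ∂P := by
  let e : ℕ → Ω → ℝ := fun n o ↦ max (g n o - h o) 0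
  have hgint (n : ℕ) : Integrable (g n) P := memLp_one_iff_integrable.1 (hg.memLp n)
  have heint (n : ℕ) : Integrable (e n) P := ((hgint n).sub hh).pos_part
  have heui : UnifIntegrable e 1 P := by
    have hsub := hg.unifIntegrable.sub
      (unifIntegrable_const le_rfl ENNReal.one_ne_top (memLp_one_iff_integrable.2 hh)) le_rfl
      hg.aestronglyMeasurable fun _ ↦ hh.aestronglyMeasurable
    refine unifIntegrable_of_norm_le hsub fun n o ↦ ?_
    simp only [e, Pi.sub_apply, Real.norm_eq_abs, abs_of_nonneg (le_max_right _ (0 : ℝ))]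
    exact max_le (le_abs_self _) (abs_nonneg _)
  have hezero : ∀ᵐ o ∂P, Tendsto (fun n ↦ e n o) atTop (𝓝 0) := by
    filter_upwards [hgh] with o ho
    refine tendsto_const_nhds.congr' (ho.mono fun n hn ↦ ?_)
    exact (max_eq_right (sub_nonpos.2 hn)).symm
  have hlim : Tendsto (fun n ↦ ∫ o, e n o ∂P) atTop (𝓝 0) := by
    simpa using tendsto_integral_of_L1' 0 aestronglyMeasurable_zero (Eventually.of_forall heint)
      (tendsto_Lp_finite_of_tendsto_ae le_rfl ENNReal.one_ne_top
        (fun n ↦ (heint n).aestronglyMeasurable) MemLp.zero heui hezero)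
  refine ge_of_tendsto' (by simpa using hlim.const_add (∫ o, h o ∂P)) fun n ↦ (hc n).trans ?_
  rw [← integral_add hh (heint n)]
  refine integral_mono (hgint n) (hh.add (heint n)) fun o ↦ ?_
  linarith [le_max_left (g n o - h o) 0]

section StoppedValue

variable {ι : Type*} [LinearOrder ι] [TopologicalSpace ι] [OrderTopology ι]
  [FirstCountableTopology ι] [Nonempty ι] {ℱ : Filtration ι mΩ} {Z : ι → Ω → ℝ}

theorem uniformIntegrable_stoppedValue [IsFiniteMeasure P] (hZ : Martingale Z ℱ P) {κ : Type*}
    {τ : κ → Ω → WithTop ι} (hτ : ∀ k, IsStoppingTime ℱ (τ k)) {n : ι} (hτn : ∀ k o, τ k o ≤ n)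
    (hcount : ∀ k, (range (τ k)).Countable) :
    UniformIntegrable (fun k ↦ stoppedValue Z (τ k)) 1 P :=
  ((hZ.integrable n).uniformIntegrable_condExp fun k ↦ (hτ k).measurableSpace_le).ae_eq fun k ↦
    (hZ.stoppedValue_ae_eq_condExp_of_le_const_of_countable_range (hτ k) (hτn k) (hcount k)).symm

theorem integral_stoppedValue_eq_integral [IsFiniteMeasure P] (hZ : Martingale Z ℱ P)
    {τ : Ω → WithTop ι} (hτ : IsStoppingTime ℱ τ) {n : ι} (hτn : ∀ o, τ o ≤ n)
    (hcount : (range τ).Countable) : ∫ o, stoppedValue Z τ o ∂P = ∫ o, Z n o ∂P := by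
  rw [integral_congr_ae
    (hZ.stoppedValue_ae_eq_condExp_of_le_const_of_countable_range hτ hτn hcount),
    integral_condExp hτ.measurableSpace_le]

end StoppedValue

section HittingTimeAlong

variable {ι β : Type*}

/-- The first of the times `g 0, g 1, …, g n` at which the process `X` is in `S`, or `g n` if there
is no such time: a discretized hitting time that takes finitely many values, which makes it amenable
to optional stopping. -/
noncomputable def hittingTimeAlong (X : ι → Ω → β) (S : Set β) (g : ℕ → ι) (n : ℕ) (o : Ω) : ι :=
  g (hittingBtwn (fun k ↦ X (g k)) S 0 n o)

theorem hittingTimeAlong_le [Preorder ι] {g : ℕ → ι} (hg : Monotone g) (X : ι → Ω → β) (S : Set β)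
    (n : ℕ) (o : Ω) : hittingTimeAlong X S g n o ≤ g n :=
  hg (hittingBtwn_le o)

theorem hittingTimeAlong_eq_of_forall_notMem {X : ι → Ω → β} {S : Set β} {g : ℕ → ι} {n : ℕ} {o : Ω}
    (h : ∀ k < n, X (g k) o ∉ S) : hittingTimeAlong X S g n o = g n := by
  have hn : n ≤ hittingBtwn (fun k ↦ X (g k)) S 0 n o := by
    by_contra! hlt
    exact h _ hlt (hittingBtwn_mem_set_of_hittingBtwn_lt hlt)
  exact congrArg g ((hittingBtwn_le o).antisymm hn)

theorem countable_range_coe_hittingTimeAlong (X : ι → Ω → β) (S : Set β) (g : ℕ → ι) (n : ℕ) :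
    (range fun o ↦ ((hittingTimeAlong X S g n o : ι) : WithTop ι)).Countable :=
  (countable_range fun k ↦ (g k : WithTop ι)).mono <|
    range_subset_iff.2 fun o ↦ mem_range_self (hittingBtwn (fun k ↦ X (g k)) S 0 n o)

theorem isStoppingTime_hittingTimeAlong [Preorder ι] [MeasurableSpace β] {ℱ : Filtration ι mΩ}
    {X : ι → Ω → β} (hX : Adapted ℱ X) {S : Set β} (hS : MeasurableSet S) {g : ℕ → ι}
    (hg : Monotone g) (n : ℕ) :
    IsStoppingTime ℱ fun o ↦ ((hittingTimeAlong X S g n o : ι) : WithTop ι) := by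
  intro t
  let 𝒢 : Filtration ℕ mΩ := ⟨fun k ↦ ℱ (g k), fun _ _ hij ↦ ℱ.mono (hg hij), fun k ↦ ℱ.le (g k)⟩
  let σ (o : Ω) : ℕ := hittingBtwn (fun k ↦ X (g k)) S 0 n o
  have hσ : IsStoppingTime 𝒢 fun o ↦ (σ o : WithTop ℕ) :=
    Adapted.isStoppingTime_hittingBtwn (fun k ↦ hX (g k)) hS
  have hunion : {o | ((hittingTimeAlong X S g n o : ι) : WithTop ι) ≤ t}
      = ⋃ k ∈ {k | g k ≤ t}, {o | (σ o : WithTop ℕ) = k} := by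
    ext o
    simp [hittingTimeAlong, σ]
  rw [hunion]
  exact MeasurableSet.biUnion (to_countable _) fun k hk ↦ ℱ.mono hk _ (hσ.measurableSet_eq k)

end HittingTimeAlong

section UniformGrid

/-- The points `0, t / N, 2 t / N, …` of the uniform grid that divides `[0, t]` into `N` steps; for
`N = 0` they are all `0`. -/
noncomputable def uniformGrid (t : ℝ≥0) (N k : ℕ) : ℝ≥0 := k * (t / N)

theorem monotone_uniformGrid (t : ℝ≥0) (N : ℕ) : Monotone (uniformGrid t N) := fun _ _ hij ↦ by
  unfold uniformGrid
  gcongr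

theorem uniformGrid_zero_right (t : ℝ≥0) (N : ℕ) : uniformGrid t N 0 = 0 := by
  simp [uniformGrid]

theorem uniformGrid_self {t : ℝ≥0} {N : ℕ} (hN : N ≠ 0) : uniformGrid t N N = t :=
  mul_div_cancel₀ _ (Nat.cast_ne_zero.2 hN)

theorem uniformGrid_self_le (t : ℝ≥0) (N : ℕ) : uniformGrid t N N ≤ t := by
  rcases eq_or_ne N 0 with rfl | hN
  · simp [uniformGrid]
  · exact (uniformGrid_self hN).le

theorem exists_uniformGrid_le_and_le_add {t s : ℝ≥0} {N j : ℕ} (hs : s ≤ uniformGrid t N j)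
    (hj : 0 < j) : ∃ k < j, uniformGrid t N k ≤ s ∧ s ≤ uniformGrid t N k + t / N := by
  induction j, hj using Nat.le_induction with
  | base => exact ⟨0, one_pos, by simp [uniformGrid], by simpa [uniformGrid] using hs⟩
  | succ j _ ih =>
    rcases le_total (uniformGrid t N j) s with h | h
    · exact ⟨j, j.lt_succ_self, h, hs.trans_eq (by simp only [uniformGrid]; push_cast; ring)⟩
    · obtain ⟨k, hkj, hk⟩ := ih h
      exact ⟨k, hkj.trans j.lt_succ_self, hk⟩

theorem tendsto_nnreal_const_div_natCast (t : ℝ≥0) :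
    Tendsto (fun N : ℕ ↦ t / N) atTop (𝓝 0) := by
  simpa using tendsto_const_div_atTop_nhds_zero_nat t

end UniformGrid

section ContinuousPath

variable {M : Type*} [TopologicalSpace M]

theorem eventually_forall_le_uniformGrid_mem {γ : ℝ≥0 → M} (hγ : Continuous γ) {K U : Set M}
    (hK : IsClosed K) (hU : IsOpen U) (hKU : K ⊆ U) (h0 : γ 0 ∈ K) (t : ℝ≥0) :
    ∀ᶠ N : ℕ in atTop, ∀ j ≤ N, (∀ k < j, γ (uniformGrid t N k) ∈ K) →
      ∀ s ≤ uniformGrid t N j, γ s ∈ U := by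
  have hC : IsCompact (Icc 0 t ∩ γ ⁻¹' K) := isCompact_Icc.inter_right (hK.preimage hγ)
  obtain ⟨δ, hδ, hδU⟩ := hC.exists_thickening_subset_open (hU.preimage hγ)
    (inter_subset_right.trans (preimage_mono hKU))
  filter_upwards [(tendsto_nnreal_const_div_natCast t).eventually_lt_const (Real.toNNReal_pos.2 hδ)]
    with N hN j hjN hjK s hs
  rcases j.eq_zero_or_pos with rfl | hj
  · rw [uniformGrid_zero_right, nonpos_iff_eq_zero] at hs
    exact hKU (hs ▸ h0)
  obtain ⟨k, hkj, hks, hsk⟩ := exists_uniformGrid_le_and_le_add hs hj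
  have hst : s ≤ t := hs.trans <| (monotone_uniformGrid t N hjN).trans (uniformGrid_self_le t N)
  refine hδU (Metric.mem_thickening_iff.2 ⟨_, ⟨⟨zero_le, hks.trans hst⟩, hjK k hkj⟩, ?_⟩)
  rw [NNReal.dist_eq, abs_of_nonneg (sub_nonneg.2 (NNReal.coe_le_coe.2 hks))]
  have hsk' : (s : ℝ) ≤ uniformGrid t N k + (t / N : ℝ≥0) := by exact_mod_cast hsk
  have hNδ : ((t / N : ℝ≥0) : ℝ) < δ := Real.lt_toNNReal_iff_coe_lt.1 hN
  linarith

theorem eventually_forall_le_hittingTimeAlong_mem {X : ℝ≥0 → Ω → M} {o : Ω}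
    (hX : Continuous fun t ↦ X t o) {K U : Set M} (hK : IsClosed K) (hU : IsOpen U) (hKU : K ⊆ U)
    (h0 : X 0 o ∈ K) (t : ℝ≥0) :
    ∀ᶠ N : ℕ in atTop, ∀ s ≤ hittingTimeAlong X Kᶜ (uniformGrid t N) N o, X s o ∈ U := by
  filter_upwards [eventually_forall_le_uniformGrid_mem hX hK hU hKU h0 t] with N hN
  exact hN _ (hittingBtwn_le o) fun k hk ↦ by simpa using notMem_of_lt_hittingBtwn hk k.zero_le

theorem tendsto_measureReal_forall_le_mem_compactExhaustion [IsProbabilityMeasure P]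
    {X : ℝ≥0 → Ω → M} (hXc : ∀ o, Continuous fun t ↦ X t o) (K : CompactExhaustion M) (t : ℝ≥0) :
    Tendsto (fun n ↦ P.real {o | ∀ s ≤ t, X s o ∈ K n}) atTop (𝓝 1) := by
  have hmono : Monotone fun n ↦ {o | ∀ s ≤ t, X s o ∈ K n} :=
    fun _ _ hij _ ho s hs ↦ K.subset hij (ho s hs)
  have hunion : ⋃ n, {o | ∀ s ≤ t, X s o ∈ K n} = univ := by
    refine eq_univ_of_forall fun o ↦ mem_iUnion.2 ?_
    obtain ⟨n, hn⟩ := K.exists_superset_of_isCompact (isCompact_Icc.image (hXc o))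
    exact ⟨n, fun s hs ↦ hn ⟨s, ⟨zero_le, hs⟩, rfl⟩⟩
  have hlim := tendsto_measure_iUnion_atTop (μ := P) hmono
  rw [hunion, measure_univ] at hlim
  exact (ENNReal.tendsto_toReal ENNReal.one_ne_top).comp hlim

variable [MeasurableSpace M] [BorelSpace M]

theorem measurableSet_forall_le_mem {X : ℝ≥0 → Ω → M} (hXm : ∀ t, Measurable (X t))
    (hXc : ∀ o, Continuous fun t ↦ X t o) {K : Set M} (hK : IsClosed K) (t : ℝ≥0) :
    MeasurableSet {o | ∀ s ≤ t, X s o ∈ K} := by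
  have hdense : {o | ∀ s ≤ t, X s o ∈ K}
      = ⋂ n : ℕ, X (min (TopologicalSpace.denseSeq ℝ≥0 n) t) ⁻¹' K := by
    ext o
    simp only [mem_ofPred_eq, mem_iInter, mem_preimage]
    refine ⟨fun h n ↦ h _ (min_le_right _ _), fun h s hs ↦ ?_⟩
    have hclosed : IsClosed {r : ℝ≥0 | X (min r t) o ∈ K} :=
      hK.preimage ((hXc o).comp (continuous_id.min continuous_const))
    simpa only [min_eq_left hs] using
      (TopologicalSpace.denseRange_denseSeq ℝ≥0).induction_on (p := fun r ↦ X (min r t) o ∈ K)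
        s hclosed h
  rw [hdense]
  exact MeasurableSet.iInter fun n ↦ hXm _ hK.measurableSet

/-- Stop at the grid times at which the exit from `K` is noticed; the neighbourhood `U` leaves room
for the excursions that are noticed late. -/
theorem integral_zero_le_neg_mul_measureReal_forall_le_mem [IsProbabilityMeasure P]
    {ℱ : Filtration ℝ≥0 mΩ} {X : ℝ≥0 → Ω → M} (hX : Adapted ℱ X)
    (hXc : ∀ o, Continuous fun t ↦ X t o) {K U : Set M} (hK : IsClosed K) (hU : IsOpen U)
    (hKU : K ⊆ U) (hX0 : ∀ᵐ o ∂P, X 0 o ∈ K) {Z : ℝ≥0 → Ω → ℝ} (hZ : Martingale Z ℱ P) {c : ℝ}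
    (hc : 0 ≤ c) (hZU : ∀ o r, (∀ s ≤ r, X s o ∈ U) → Z r o ≤ -(c * r)) (t : ℝ≥0) :
    ∫ o, Z 0 o ∂P ≤ -(c * t * P.real {o | ∀ s ≤ t, X s o ∈ K}) := by
  set A : Set Ω := {o | ∀ s ≤ t, X s o ∈ K}
  have hA : MeasurableSet A :=
    measurableSet_forall_le_mem (fun s ↦ (hX s).mono (ℱ.le s) le_rfl) hXc hK t
  let τ (N : ℕ) (o : Ω) : ℝ≥0 := hittingTimeAlong X Kᶜ (uniformGrid t N) N o
  have hτ (N : ℕ) : IsStoppingTime ℱ fun o ↦ (τ N o : WithTop ℝ≥0) :=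
    isStoppingTime_hittingTimeAlong hX hK.measurableSet.compl (monotone_uniformGrid t N) N
  have hτt (N : ℕ) (o : Ω) : (τ N o : WithTop ℝ≥0) ≤ t := WithTop.coe_le_coe.2 <|
    (hittingTimeAlong_le (monotone_uniformGrid t N) X Kᶜ N o).trans (uniformGrid_self_le t N)
  have hcount (N : ℕ) := countable_range_coe_hittingTimeAlong X Kᶜ (uniformGrid t N) N
  have hmean (N : ℕ) : ∫ o, Z 0 o ∂P = ∫ o, stoppedValue Z (fun o ↦ τ N o) o ∂P := by
    rw [integral_stoppedValue_eq_integral hZ (hτ N) (hτt N) (hcount N)]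
    simpa using hZ.setIntegral_eq zero_le MeasurableSet.univ
  have hbound : ∀ᵐ o ∂P, ∀ᶠ N : ℕ in atTop,
      stoppedValue Z (fun o ↦ τ N o) o ≤ A.indicator (fun _ ↦ -(c * t)) o := by
    filter_upwards [hX0] with o ho
    filter_upwards [eventually_forall_le_hittingTimeAlong_mem (hXc o) hK hU hKU ho t,
      eventually_ne_atTop 0] with N hN hN0
    refine (hZU o (τ N o) hN).trans ?_
    by_cases hoA : o ∈ A
    · have hτo : τ N o = t := by
        refine (hittingTimeAlong_eq_of_forall_notMem fun k hk ↦ ?_).trans (uniformGrid_self hN0)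
        simpa using hoA _ <| (monotone_uniformGrid t N hk.le).trans (uniformGrid_self_le t N)
      simp [hoA, hτo]
    · simpa [hoA] using mul_nonneg hc (τ N o).coe_nonneg
  calc ∫ o, Z 0 o ∂P
      ≤ ∫ o, A.indicator (fun _ ↦ -(c * t)) o ∂P :=
        le_integral_of_forall_le_integral_of_eventually_le
          (uniformIntegrable_stoppedValue hZ hτ hτt hcount) ((integrable_const _).indicator hA)
          hbound fun N ↦ (hmean N).le
    _ = -(c * t * P.real A) := by
        rw [integral_indicator hA, setIntegral_const, smul_eq_mul]
        ring

end ContinuousPath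

end Probability

section Gram

variable {ι E : Type*} [Fintype ι] [NormedAddCommGroup E] [InnerProductSpace ℝ E]

theorem inner_sum_smul_eq_gram_mulVec (a : ι → E) (c : ι → ℝ) (j : ι) :
    inner ℝ (a j) (∑ k, c k • a k) = (Matrix.gram ℝ a).mulVec c j := by
  simp [inner_sum, inner_smul_right, Matrix.mulVec, dotProduct, mul_comm]

variable [DecidableEq ι] in
theorem sum_gram_inv_mul_inner_mul_inner {a : ι → E} (ha : LinearIndependent ℝ a)
    [(Submodule.span ℝ (range a)).HasOrthogonalProjection] (v w : E) :
    ∑ i, ∑ j, (Matrix.gram ℝ a)⁻¹ i j * (inner ℝ (a i) v * inner ℝ (a j) w)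
      = inner ℝ v ((Submodule.span ℝ (range a)).starProjection w) := by
  set S := Submodule.span ℝ (range a)
  obtain ⟨c, hc⟩ :=
    (Submodule.mem_span_range_iff_exists_fun ℝ).1 (S.starProjection_apply_mem w)
  have hw (j : ι) : inner ℝ (a j) w = (Matrix.gram ℝ a).mulVec c j := by
    rw [← inner_sum_smul_eq_gram_mulVec, hc, ← Submodule.inner_starProjection_left_eq_right,
      Submodule.starProjection_eq_self_iff.2 (Submodule.subset_span (mem_range_self j))]
  have hinv : (Matrix.gram ℝ a)⁻¹.mulVec ((Matrix.gram ℝ a).mulVec c) = c := by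
    rw [Matrix.mulVec_mulVec, Matrix.nonsing_inv_mul _
      (isUnit_iff_ne_zero.2 (Matrix.det_gram_ne_zero_iff_linearIndependent.2 ha)),
      Matrix.one_mulVec]
  calc ∑ i, ∑ j, (Matrix.gram ℝ a)⁻¹ i j * (inner ℝ (a i) v * inner ℝ (a j) w)
      = ∑ i, inner ℝ (a i) v * (Matrix.gram ℝ a)⁻¹.mulVec ((Matrix.gram ℝ a).mulVec c) i := by
        simp only [hw, Matrix.mulVec, dotProduct, Finset.mul_sum, mul_left_comm]
    _ = inner ℝ v (S.starProjection w) := by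
        simp only [hinv, ← hc, inner_sum, inner_smul_right, real_inner_comm v, mul_comm]

end Gram

section CoordDeriv

variable {m : ℕ} {F G : Type*} [NormedAddCommGroup F] [NormedSpace ℝ F]
  [NormedAddCommGroup G] [NormedSpace ℝ G] {h₁ h₂ : Euc m → F} {y : Euc m}

theorem coordDeriv_eventuallyEq (h : h₁ =ᶠ[𝓝 y] h₂) (i : Fin m) :
    coordDeriv i h₁ =ᶠ[𝓝 y] coordDeriv i h₂ :=
  (h.fderiv (𝕜 := ℝ)).mono fun z hz ↦ by simp only [coordDeriv, hz]

theorem coordDeriv_clm_comp (ℓ : F →L[ℝ] G) (h : DifferentiableAt ℝ h₁ y) (i : Fin m) :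
    coordDeriv i (fun z ↦ ℓ (h₁ z)) y = ℓ (coordDeriv i h₁ y) := by
  simp [coordDeriv, (ℓ.hasFDerivAt.comp y h.hasFDerivAt).fderiv, ← Function.comp_def]

theorem coordDeriv_clm_comp_eventuallyEq (ℓ : F →L[ℝ] G) (h : ContDiffAt ℝ 1 h₁ y) (i : Fin m) :
    coordDeriv i (fun z ↦ ℓ (h₁ z)) =ᶠ[𝓝 y] fun z ↦ ℓ (coordDeriv i h₁ z) :=
  (h.eventually (by simp)).mono fun _ hz ↦ coordDeriv_clm_comp ℓ (hz.differentiableAt (by simp)) i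

theorem differentiableAt_coordDeriv (h : ContDiffAt ℝ 2 h₁ y) (i : Fin m) :
    DifferentiableAt ℝ (coordDeriv i h₁) y :=
  ((h.fderiv_right (m := 1) (by norm_num)).differentiableAt (by simp)).clm_apply
    (differentiableAt_const _)

theorem coordDeriv_coordDeriv_clm_comp (ℓ : F →L[ℝ] G) (h : ContDiffAt ℝ 2 h₁ y) (i j : Fin m) :
    coordDeriv i (coordDeriv j fun z ↦ ℓ (h₁ z)) y = ℓ (coordDeriv i (coordDeriv j h₁) y) := by
  rw [(coordDeriv_eventuallyEq (coordDeriv_clm_comp_eventuallyEq ℓ (h.of_le (by norm_num)) j)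
    i).self_of_nhds, coordDeriv_clm_comp ℓ (differentiableAt_coordDeriv h j)]

theorem coordDeriv_neg (h : Euc m → F) (i : Fin m) : coordDeriv i (-h) = -coordDeriv i h := by
  ext1 z
  simp [coordDeriv, fderiv_neg]

theorem coordDeriv_sub_const (h : Euc m → F) (b : F) (i : Fin m) :
    coordDeriv i (fun z ↦ h z - b) = coordDeriv i h := by
  ext1 z
  simp only [coordDeriv, fderiv_sub_const]

end CoordDeriv

section Chart

variable {m : ℕ} {M : Type*} [TopologicalSpace M] [ChartedSpace (Euc m) M]
  {F : Type*} [NormedAddCommGroup F] [NormedSpace ℝ F]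

variable (m) in
/-- The partial derivatives `∂_1 x (p), …, ∂_m x (p)` of `x` in the preferred chart around `p`. -/
noncomputable def chartPartial (x : M → F) (p : M) (i : Fin m) : F :=
  coordDeriv i (x ∘ (extChartAt (𝓡 m) p).symm) (extChartAt (𝓡 m) p p)

variable [IsManifold (𝓡 m) ∞ M]

theorem contMDiffAt_extChartAt_symm_self (p : M) :
    ContMDiffAt 𝓘(ℝ, Euc m) (𝓡 m) ∞ (extChartAt (𝓡 m) p).symm (extChartAt (𝓡 m) p p) :=
  (contMDiffOn_extChartAt_symm p).contMDiffAt (extChartAt_target_mem_nhds p)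

theorem contDiffAt_comp_extChartAt_symm {x : M → F} (hx : ContMDiff (𝓡 m) 𝓘(ℝ, F) ∞ x) (p : M) :
    ContDiffAt ℝ ∞ (x ∘ (extChartAt (𝓡 m) p).symm) (extChartAt (𝓡 m) p p) :=
  (hx.contMDiffAt.comp _ (contMDiffAt_extChartAt_symm_self p)).contDiffAt

theorem chartPartial_clm_comp {G : Type*} [NormedAddCommGroup G] [NormedSpace ℝ G] (ℓ : F →L[ℝ] G)
    {x : M → F} (hx : ContMDiff (𝓡 m) 𝓘(ℝ, F) ∞ x) (p : M) (i : Fin m) :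
    chartPartial m (fun q ↦ ℓ (x q)) p i = ℓ (chartPartial m x p i) :=
  coordDeriv_clm_comp ℓ ((contDiffAt_comp_extChartAt_symm hx p).differentiableAt (by simp)) i

theorem chartPartial_inner {n : ℕ} {x : M → Euc n}
    (hx : ContMDiff (𝓡 m) 𝓘(ℝ, Euc n) ∞ x) (w : Euc n) (p : M) (i : Fin m) :
    chartPartial m (fun q ↦ inner ℝ (x q) w) p i = inner ℝ (chartPartial m x p i) w := by
  simpa only [innerSL_apply_apply, real_inner_comm] using
    chartPartial_clm_comp (innerSL ℝ w) hx p i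

theorem chartSymmDeriv_bijective (p : M) :
    Function.Bijective (chartSymmDeriv p (extChartAt (𝓡 m) p p)) := by
  have h := isInvertible_mfderivWithin_extChartAt_symm (I := 𝓡 m) (mem_extChartAt_target p)
  rw [ModelWithCorners.range_eq_univ, mfderivWithin_univ] at h
  obtain ⟨e, he⟩ := h
  rw [chartSymmDeriv, ← he]
  exact e.bijective

theorem chartPartial_eq_differential {n : ℕ} {x : M → Euc n}
    (hx : ContMDiff (𝓡 m) 𝓘(ℝ, Euc n) ∞ x) (p : M) (i : Fin m) :
    chartPartial m x p i = differential m x ((extChartAt (𝓡 m) p).symm (extChartAt (𝓡 m) p p))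
      (chartSymmDeriv p (extChartAt (𝓡 m) p p) (EuclideanSpace.single i 1)) := by
  have hchain := mfderiv_comp (extChartAt (𝓡 m) p p)
    (hx.mdifferentiableAt (by simp) (x := (extChartAt (𝓡 m) p).symm _))
    ((contMDiffAt_extChartAt_symm_self p).mdifferentiableAt (by simp))
  rw [chartPartial, coordDeriv, ← mfderiv_eq_fderiv, hchain]
  rfl

theorem span_chartPartial {n : ℕ} {x : M → Euc n} (hx : ContMDiff (𝓡 m) 𝓘(ℝ, Euc n) ∞ x) (p : M) :
    Submodule.span ℝ (range (chartPartial m x p))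
      = LinearMap.range (differential m x p).toLinearMap := by
  set T : Euc m →ₗ[ℝ] Euc n :=
    (differential m x ((extChartAt (𝓡 m) p).symm (extChartAt (𝓡 m) p p))).toLinearMap ∘ₗ
      (chartSymmDeriv p (extChartAt (𝓡 m) p p)).toLinearMap with hT
  have hpartial : chartPartial m x p = T ∘ EuclideanSpace.basisFun (Fin m) ℝ := by
    ext1 i
    rw [chartPartial_eq_differential hx, Function.comp_apply, EuclideanSpace.basisFun_apply]
    rfl
  rw [hpartial, range_comp, Submodule.span_image, ← OrthonormalBasis.coe_toBasis,
    Module.Basis.span_eq, ← LinearMap.range_eq_map, hT, LinearMap.range_comp_of_range_eq_top _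
      (LinearMap.range_eq_top.2 (chartSymmDeriv_bijective p).2), extChartAt_to_inv]

end Chart

section LocalExpressions

variable {m : ℕ} {M : Type*} [TopologicalSpace M] [ChartedSpace (Euc m) M]
  [RiemannianBundle (fun p : M ↦ TangentSpace (𝓡 m) p)]

theorem weightedLaplacian_congr {f w₁ w₂ : M → ℝ} {p : M} (h : w₁ =ᶠ[𝓝 p] w₂) :
    weightedLaplacian m f w₁ p = weightedLaplacian m f w₂ p := by
  have hchart : w₁ ∘ (extChartAt (𝓡 m) p).symm =ᶠ[𝓝 (extChartAt (𝓡 m) p p)]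
      w₂ ∘ (extChartAt (𝓡 m) p).symm := by
    have hcont := (continuousAt_extChartAt_symm (I := 𝓡 m) p).tendsto
    rw [extChartAt_to_inv] at hcont
    exact hcont.eventually h
  have hfst (i : Fin m) := coordDeriv_eventuallyEq hchart i
  have hsnd (i j : Fin m) := (coordDeriv_eventuallyEq (hfst j) i).self_of_nhds
  simp only [weightedLaplacian, traceHessInChart, gradInnerInChart, hessCoeff, hsnd,
    fun i ↦ (hfst i).self_of_nhds]

theorem weightedLaplacian_sub_const (f w : M → ℝ) (b : ℝ) :
    weightedLaplacian m f (fun q ↦ w q - b) = weightedLaplacian m f w := by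
  ext p
  have hcomp : (fun q ↦ w q - b) ∘ (extChartAt (𝓡 m) p).symm
      = fun z ↦ (w ∘ (extChartAt (𝓡 m) p).symm) z - b := rfl
  simp only [weightedLaplacian, traceHessInChart, gradInnerInChart, hessCoeff, hcomp,
    coordDeriv_sub_const]

theorem gradInnerInChart_neg_left (f w : M → ℝ) (c : M) (y : Euc m) :
    gradInnerInChart (fun q ↦ -f q) w c y = -gradInnerInChart f w c y := by
  have hcomp : (fun q ↦ -f q) ∘ (extChartAt (𝓡 m) c).symm
      = -(f ∘ (extChartAt (𝓡 m) c).symm) := rfl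
  simp only [gradInnerInChart, hcomp, coordDeriv_neg, Pi.neg_apply, neg_mul, mul_neg,
    Finset.sum_neg_distrib]

theorem traceHessInChart_clm_comp {F G : Type*} [NormedAddCommGroup F] [NormedSpace ℝ F]
    [NormedAddCommGroup G] [NormedSpace ℝ G] (ℓ : F →L[ℝ] G) {x : M → F} {c : M} {y : Euc m}
    (hx : ContDiffAt ℝ 2 (x ∘ (extChartAt (𝓡 m) c).symm) y) :
    traceHessInChart (fun p ↦ ℓ (x p)) c y = ℓ (traceHessInChart x c y) := by
  have hcomp : (fun p ↦ ℓ (x p)) ∘ (extChartAt (𝓡 m) c).symm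
      = fun z ↦ ℓ ((x ∘ (extChartAt (𝓡 m) c).symm) z) := rfl
  simp only [traceHessInChart, hessCoeff, hcomp, coordDeriv_coordDeriv_clm_comp ℓ hx,
    coordDeriv_clm_comp ℓ (hx.differentiableAt (by simp)), map_sum, map_smul, map_sub]

end LocalExpressions

section IsometricImmersion

variable {m n : ℕ} {M : Type*} [TopologicalSpace M] [ChartedSpace (Euc m) M]
  [RiemannianBundle (fun p : M ↦ TangentSpace (𝓡 m) p)]

variable (m) in
/-- `x : M → ℝ^n` is a smooth isometric immersion, of arbitrary codimension. -/
structure IsIsometricImmersion (x : M → Euc n) : Prop where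
  smooth : ContMDiff (𝓡 m) 𝓘(ℝ, Euc n) ∞ x
  isometric : ∀ (p : M) (X Y : TangentSpace (𝓡 m) p),
    inner ℝ (differential m x p X) (differential m x p Y) = inner ℝ X Y

variable {x : M → Euc n}

theorem IsIsometricImmersion.differential_injective (hx : IsIsometricImmersion m x) (p : M) :
    Function.Injective (differential m x p) := by
  refine (injective_iff_map_eq_zero _).2 fun X hX ↦ ?_
  have h := hx.isometric p X X
  rw [hX, inner_zero_left] at h
  exact inner_self_eq_zero.1 h.symm

variable [IsManifold (𝓡 m) ∞ M]

theorem IsIsometricImmersion.metricCoeff_eq_gram (hx : IsIsometricImmersion m x) (p : M) :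
    metricCoeff p (extChartAt (𝓡 m) p p) = Matrix.gram ℝ (chartPartial m x p) := by
  ext i j
  rw [Matrix.gram_apply, chartPartial_eq_differential hx.smooth,
    chartPartial_eq_differential hx.smooth, hx.isometric]
  rfl

theorem IsIsometricImmersion.linearIndependent_chartPartial (hx : IsIsometricImmersion m x)
    (p : M) : LinearIndependent ℝ (chartPartial m x p) := by
  rw [linearIndependent_iff_card_eq_finrank_span, Set.finrank, span_chartPartial hx.smooth,
    LinearMap.finrank_range_of_inj (hx.differential_injective p)]
  exact (Fintype.card_fin m).trans (finrank_euclideanSpace_fin (𝕜 := ℝ) (n := m)).symm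

theorem traceHessInChart_inner (hx : ContMDiff (𝓡 m) 𝓘(ℝ, Euc n) ∞ x) (w : Euc n) (p : M) :
    traceHessInChart (fun q ↦ inner ℝ (x q) w) p (extChartAt (𝓡 m) p p)
      = inner ℝ (meanCurvatureVector m x p) w := by
  simpa only [innerSL_apply_apply, real_inner_comm, meanCurvatureVector] using
    traceHessInChart_clm_comp (innerSL ℝ w)
      (contDiffAt_infty.1 (contDiffAt_comp_extChartAt_symm hx p) 2)

theorem IsIsometricImmersion.gradInnerInChart_inner (hx : IsIsometricImmersion m x)
    (v w : Euc n) (p : M) :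
    gradInnerInChart (fun q ↦ inner ℝ (x q) v) (fun q ↦ inner ℝ (x q) w) p
        (extChartAt (𝓡 m) p p)
      = inner ℝ v ((LinearMap.range (differential m x p).toLinearMap).starProjection w) := by
  have h := sum_gram_inv_mul_inner_mul_inner (hx.linearIndependent_chartPartial p) v w
  simp only [← hx.metricCoeff_eq_gram, ← chartPartial_inner hx.smooth,
    span_chartPartial hx.smooth] at h
  exact h

theorem IsIsometricImmersion.weightedLaplacian_inner (hx : IsIsometricImmersion m x) {v : Euc n}
    {p : M} (hH : meanCurvatureVector m x p = normalPart m x p v) (w : Euc n) :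
    weightedLaplacian m (fun q ↦ -inner ℝ (x q) v) (fun q ↦ inner ℝ (x q) w) p = inner ℝ v w := by
  rw [weightedLaplacian, traceHessInChart_inner hx.smooth, hH, gradInnerInChart_neg_left,
    hx.gradInnerInChart_inner, sub_neg_eq_add, normalPart,
    Submodule.inner_starProjection_left_eq_right, ← inner_add_right, add_comm,
    Submodule.starProjection_add_starProjection_orthogonal]

end IsometricImmersion

section StochasticCompleteness

variable {m : ℕ} {M : Type*} [TopologicalSpace M] [T2Space M] [SigmaCompactSpace M]
  [ChartedSpace (Euc m) M] [IsManifold (𝓡 m) ∞ M]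

theorem exists_contMDiff_hasCompactSupport_nonpos_eqOn {w : M → ℝ}
    (hw : ContMDiff (𝓡 m) 𝓘(ℝ, ℝ) ∞ w) (hw0 : ∀ q, w q ≤ 0) {K : Set M} (hK : IsCompact K) :
    ∃ ψ : M → ℝ, ContMDiff (𝓡 m) 𝓘(ℝ, ℝ) ∞ ψ ∧ HasCompactSupport ψ ∧ (∀ q, ψ q ≤ 0) ∧
      ∃ U : Set M, IsOpen U ∧ K ⊆ U ∧ EqOn ψ w U := by
  have : LocallyCompactSpace M := Manifold.locallyCompact_of_finiteDimensional (𝓡 m)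
  obtain ⟨K', hK', hKK'⟩ := exists_compact_superset hK
  obtain ⟨φ, hφ1, hφ0, hφ⟩ := exists_contMDiffMap_one_nhds_of_subset_interior (n := ⊤) (𝓡 m)
    hK.isClosed hKK'
  obtain ⟨U, hU, hKU, hUφ⟩ := eventually_nhdsSet_iff_exists.1 hφ1
  refine ⟨fun q ↦ φ q * w q, φ.contMDiff.mul hw,
    HasCompactSupport.intro hK' fun q hq ↦ by simp [hφ0 q hq],
    fun q ↦ mul_nonpos_of_nonneg_of_nonpos (hφ q).1 (hw0 q), U, hU, hKU, fun q hq ↦ ?_⟩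
  simp [hUφ q hq]

variable [RiemannianBundle (fun p : M ↦ TangentSpace (𝓡 m) p)] {f u w : M → ℝ} {c : ℝ}
  {p : M} {Ω : Type*} [mΩ : MeasurableSpace Ω] {P : Measure Ω} {ℱ : Filtration ℝ≥0 mΩ}
  {X : ℝ≥0 → Ω → M}

theorem IsDiffusionFrom.le_neg_mul_measureReal_forall_le_mem (hX : IsDiffusionFrom m f p P ℱ X)
    (hw : ContMDiff (𝓡 m) 𝓘(ℝ, ℝ) ∞ w) (hw0 : ∀ q, w q ≤ 0) (hc : 0 ≤ c)
    (hΔ : ∀ q, weightedLaplacian m f w q = c) {K : Set M} (hK : IsCompact K) (hp : p ∈ K)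
    (t : ℝ≥0) : w p ≤ -(c * t * P.real {o | ∀ s ≤ t, X s o ∈ K}) := by
  have := hX.isProbabilityMeasure
  let _ : MeasurableSpace M := borel M
  have : BorelSpace M := ⟨rfl⟩
  obtain ⟨ψ, hψ, hψc, hψ0, U, hU, hKU, hψw⟩ :=
    exists_contMDiff_hasCompactSupport_nonpos_eqOn hw hw0 hK
  have hψΔ (q : M) (hq : q ∈ U) : weightedLaplacian m f ψ q = c :=
    (weightedLaplacian_congr (hψw.eventuallyEq_of_mem (hU.mem_nhds hq))).trans (hΔ q)
  have hX0 : ∀ᵐ o ∂P, X 0 o ∈ K := hX.start.mono fun o ho ↦ ho ▸ hp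
  let Z (t : ℝ≥0) (o : Ω) : ℝ :=
    ψ (X t o) - ∫ s in (0 : ℝ)..t, weightedLaplacian m f ψ (X s.toNNReal o)
  have hZ0 : Z 0 =ᵐ[P] fun _ ↦ w p := by
    filter_upwards [hX.start] with o ho
    simp [Z, ho, hψw (hKU hp)]
  have hZU (o : Ω) (r : ℝ≥0) (hr : ∀ s ≤ r, X s o ∈ U) : Z r o ≤ -(c * r) := by
    have hint : ∫ s in (0 : ℝ)..r, weightedLaplacian m f ψ (X s.toNNReal o) = c * r := by
      rw [intervalIntegral.integral_congr (g := fun _ ↦ c) fun s hs ↦ ?_,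
        intervalIntegral.integral_const, sub_zero, smul_eq_mul, mul_comm]
      rw [uIcc_of_le r.coe_nonneg] at hs
      exact hψΔ _ (hr _ (Real.toNNReal_le_iff_le_coe.2 hs.2))
    simpa only [Z, hint, sub_le_iff_le_add, neg_add_cancel] using hψ0 (X r o)
  calc w p = ∫ o, Z 0 o ∂P := by simp [integral_congr_ae hZ0]
    _ ≤ -(c * t * P.real {o | ∀ s ≤ t, X s o ∈ K}) :=
      integral_zero_le_neg_mul_measureReal_forall_le_mem hX.adapted hX.continuous_paths
        hK.isClosed hU hKU hX0 (hX.martingale ψ hψ hψc) hc hZU t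

theorem IsDiffusionFrom.le_neg_mul (hX : IsDiffusionFrom m f p P ℱ X)
    (hw : ContMDiff (𝓡 m) 𝓘(ℝ, ℝ) ∞ w) (hw0 : ∀ q, w q ≤ 0) (hc : 0 ≤ c)
    (hΔ : ∀ q, weightedLaplacian m f w q = c) (t : ℝ≥0) : w p ≤ -(c * t) := by
  have := hX.isProbabilityMeasure
  have : LocallyCompactSpace M := Manifold.locallyCompact_of_finiteDimensional (𝓡 m)
  let K : CompactExhaustion M := CompactExhaustion.choice M
  have hlim := ((tendsto_measureReal_forall_le_mem_compactExhaustion (P := P)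
    hX.continuous_paths K t).const_mul (c * t)).neg
  rw [mul_one] at hlim
  obtain ⟨n₀, hn₀⟩ := K.exists_mem p
  refine ge_of_tendsto hlim ((eventually_ge_atTop n₀).mono fun n hn ↦ ?_)
  exact hX.le_neg_mul_measureReal_forall_le_mem hw hw0 hc hΔ (K.isCompact n) (K.subset hn hn₀) t

theorem IsStochasticallyComplete.not_bddAbove_range [Nonempty M]
    (hf : IsStochasticallyComplete m f) (hu : ContMDiff (𝓡 m) 𝓘(ℝ, ℝ) ∞ u) (hc : 0 < c)
    (hΔ : ∀ q, weightedLaplacian m f u q = c) : ¬ BddAbove (range u) := by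
  rintro ⟨b, hb⟩
  obtain ⟨p⟩ := ‹Nonempty M›
  obtain ⟨Ω, mΩ, P, ℱ, X, hX⟩ := hf p
  have hub (q : M) : u q - b ≤ 0 := sub_nonpos.2 (hb (mem_range_self q))
  have hlinear (t : ℝ≥0) : u p - b ≤ -(c * t) :=
    hX.le_neg_mul (hu.sub contMDiff_const) hub hc.le
      (fun q ↦ (congrFun (weightedLaplacian_sub_const f u b) q).trans (hΔ q)) t
  obtain ⟨t, ht⟩ := exists_nat_gt ((b - u p) / c)
  have hlin := hlinear t
  rw [div_lt_iff₀' hc] at ht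
  push_cast at hlin
  linarith

end StochasticCompleteness

theorem IsTranslator.isIsometricImmersion {m : ℕ} {M : Type*} [EMetricSpace M]
    [ChartedSpace (Euc m) M] [RiemannianBundle (fun p : M ↦ TangentSpace (𝓡 m) p)]
    {x : M → Euc (m + 1)} {v : Euc (m + 1)} (hx : IsTranslator m x v) :
    IsIsometricImmersion m x :=
  ⟨hx.smooth, hx.isometric⟩

end TranslatorMCF

theorem mainTheorem9_general (m n : ℕ) (M : Type*) [TopologicalSpace M] [T2Space M]
    [SigmaCompactSpace M] [Nonempty M] [ChartedSpace (TranslatorMCF.Euc m) M]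
    [IsManifold (𝓡 m) ∞ M] [RiemannianBundle (fun p : M ↦ TangentSpace (𝓡 m) p)]
    (x : M → TranslatorMCF.Euc n) (v : TranslatorMCF.Euc n)
    (hx : TranslatorMCF.IsIsometricImmersion m x)
    (hH : ∀ p, TranslatorMCF.meanCurvatureVector m x p = TranslatorMCF.normalPart m x p v)
    (hv : v ≠ 0)
    (hstoch : TranslatorMCF.IsStochasticallyComplete m (fun p : M ↦ -inner ℝ (x p) v)) :
    (∀ w, 0 < inner ℝ v w → ∀ b : ℝ, ¬ Set.range x ⊆ {q | inner ℝ q w ≤ b}) ∧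
      ¬ Bornology.IsBounded (Set.range x) := by
  have hhalf (w : TranslatorMCF.Euc n) (hw : 0 < inner ℝ v w) (b : ℝ) :
      ¬ Set.range x ⊆ {q | inner ℝ q w ≤ b} := fun hb ↦
    hstoch.not_bddAbove_range ((contDiff_id.inner ℝ contDiff_const).contMDiff.comp hx.smooth) hw
      (fun p ↦ hx.weightedLaplacian_inner (hH p) w)
      ⟨b, forall_mem_range.2 fun p ↦ hb (mem_range_self p)⟩
  refine ⟨hhalf, fun hbdd ↦ ?_⟩
  obtain ⟨R, hR⟩ := hbdd.exists_norm_le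
  refine hhalf v (real_inner_self_pos.2 hv) (R * ‖v‖) fun q hq ↦ ?_
  exact (real_inner_le_norm q v).trans (by gcongr; exact hR q hq)

theorem mainTheorem9 (m : ℕ) (M : Type*) [EMetricSpace M] [SecondCountableTopology M]
    [ChartedSpace (TranslatorMCF.Euc m) M] [IsManifold (𝓡 m) ∞ M]
    [RiemannianBundle (fun p : M ↦ TangentSpace (𝓡 m) p)]
    [IsContMDiffRiemannianBundle (𝓡 m) ∞ (TranslatorMCF.Euc m)
      (fun p : M ↦ TangentSpace (𝓡 m) p)]
    [IsRiemannianManifold (𝓡 m) M]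
    (x : M → TranslatorMCF.Euc (m + 1)) (v : TranslatorMCF.Euc (m + 1))
    (hx : TranslatorMCF.IsTranslator m x v)
    (hstoch : TranslatorMCF.IsStochasticallyComplete m (fun p : M ↦ -inner ℝ (x p) v)) :
    (∀ b : ℝ, ¬ Set.range x ⊆ {q | inner ℝ q v ≤ b}) ∧
      ¬ Bornology.IsBounded (Set.range x) := by
  have := hx.connected
  have : LocallyCompactSpace M := Manifold.locallyCompact_of_finiteDimensional (𝓡 m)
  have hv : v ≠ 0 := norm_ne_zero_iff.1 (by simp [hx.norm_velocity])
  exact (mainTheorem9_general m (m + 1) M x v hx.isIsometricImmersion hx.translator_eq hv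
    hstoch).imp_left fun h ↦ h v (real_inner_self_pos.2 hv)
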